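/- All graphs are finite and may have loops and multiple edges. Let $t(H)$ denote the number of spanning trees of a graph $H$ (so $t(H)=0$ if $H$ is not connected, and $t(H)=1$ if $H$ has only one vertex). For vertices $u,v,\dots$ of $H$, let $H_{uv\cdots}$ denote the graph obtained from $H$ by identifying the vertices $u,v,\dots$ into one vertex, keeping all edges (an edge between identified vertices becomes a loop). Theorem. Let $p,q,s$ be three distinct vertices of a graph $G$, and let $G_1,G_2$ be subgraphs of $G$ with $G=G_1\cup G_2$ and $G_1\cap G_2=\{p,q,s\}$; that is, every vertex and every edge of $G$ lies in $G_1$ or $G_2$, the common vertices of $G_1$ and $G_2$ are exactly $p,q,s$, and $G_1$ and $G_2$ have no common edge. Then $$t(G)=t(G_1)\,t(G_{2,pqs})+t(G_2)\,t(G_{1,pqs})+\tfrac12\Big[a_1(-a_2+b_2+c_2)+b_1(a_2-b_2+c_2)+c_1(a_2+b_2-c_2)\Big],$$ where, for $i\in\{1,2\}$, $G_{i,pqs}=(G_i)_{pqs}$, $a_i=t((G_i)_{ps})$, $b_i=t((G_i)_{pq})$ and $c_i=t((G_i)_{qs})$. In particular, if $G_2$ is a copy of $G_1$ glued along the same three vertices,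 i.e. if there is an isomorphism $G_1\to G_2$ fixing each of $p,q,s$, then $$t(G)=4\,t(G_1)\,t(G_{1,pqs}).$$ -/

import Mathlib

open scoped Graph

namespace Graph

variable {α β : Type*}

/-- A multigraph is connected if it has a vertex and any two of its vertices are joined by a finite
chain of successively adjacent vertices. -/
def IsConnected (G : Graph α β) : Prop :=
  V(G).Nonempty ∧ ∀ x ∈ V(G), ∀ y ∈ V(G), Relation.ReflTransGen G.Adj x y

/-- The vertices `v 0, …, v n` and edges `e 0, …, e n` form a cycle of length `n + 1`: the vertices
are distinct, the edges are distinct, and `e i` joins `v i` to the cyclically next vertex. (A loop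
is a cycle of length `1`, and a pair of parallel edges is a cycle of length `2`.) -/
def IsCycle (G : Graph α β) {n : ℕ} (v : Fin (n + 1) → α) (e : Fin (n + 1) → β) : Prop :=
  Function.Injective v ∧ Function.Injective e ∧ ∀ i, G.IsLink (e i) (v i) (v (i + 1))

/-- A tree is a connected multigraph without cycles. -/
def IsTree (G : Graph α β) : Prop :=
  G.IsConnected ∧
    ∀ (n : ℕ) (v : Fin (n + 1) → α) (e : Fin (n + 1) → β), ¬ G.IsCycle v e

/-- `t(G)`: the number of spanning trees of `G`, that is, of subgraphs of `G` that contain all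
vertices of `G` and are trees. -/
noncomputable def numSpanningTrees (G : Graph α β) : ℕ :=
  {T : Graph α β | T ≤s G ∧ T.IsTree}.ncard

open Classical in
/-- The graph obtained from `G` by identifying the vertices in `S` into one vertex, for which the
element `p` of `S` serves as the name. All edges are kept; an edge with both ends in `S` becomes a
loop. -/
noncomputable def identify (G : Graph α β) (S : Set α) (p : α) : Graph α β :=
  G.map fun x => if x ∈ S then p else x

/-- `G = G₁ ∪ G₂` with `G₁ ∩ G₂ = S`: the subgraphs `G₁` and `G₂` cover `G`, their common vertices
are exactly those in `S`, and they have no edge in common. -/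
structure IsUnionAlong (G G₁ G₂ : Graph α β) (S : Set α) : Prop where
  left_le : G₁ ≤ G
  right_le : G₂ ≤ G
  vertexSet_union : V(G₁) ∪ V(G₂) = V(G)
  edgeSet_union : E(G₁) ∪ E(G₂) = E(G)
  vertexSet_inter : V(G₁) ∩ V(G₂) = S
  edgeSet_inter : E(G₁) ∩ E(G₂) = ∅

/-- `H` is a copy of `G` in which the vertices of `S` are the same as in `G`: there is an
isomorphism (a bijection of vertices and a bijection of edges that respect the ends of edges) from
`G` to `H` that fixes every element of `S`. -/
def IsCopyFixing (G H : Graph α β) (S : Set α) : Prop :=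
  ∃ (f : α → α) (g : β → β),
    Set.BijOn f V(G) V(H) ∧ Set.BijOn g E(G) E(H) ∧
    (∀ e ∈ E(G), ∀ x ∈ V(G), ∀ y ∈ V(G), G.IsLink e x y ↔ H.IsLink (g e) (f x) (f y)) ∧
    ∀ x ∈ S, f x = x

end Graph

/-! By the matrix-tree theorem, `t` of a graph, or of the graph with a vertex set identified, is the
principal minor of the Laplacian on the vertices that remain after deleting one vertex, or the
identified set. All counts belonging to `G₁` and `G₂` are thus minors of two Laplacians `K₁` and
`K₂`, and the Laplacian of `G` is `K₁ + K₂`.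

Let `I₁`, `I₂` be the sets of non-terminal vertices. Eliminating them reduces each side to a
symmetric Schur complement `Sᵢ` on `{p, q, s}` with zero row sums. Neither elimination affects the
other side, so `t(G) = w₁ w₂ det (S₁ + S₂)` on the rows `p, q`, where `wᵢ = t(G_{i,pqs})`
(`principalMinor_add_union`). The zero row sums make `aᵢ, bᵢ, cᵢ` equal to `wᵢ` times the diagonal
entries at `q, s, p`, and these determine `Sᵢ` (`principalMinor_three`). The theorem is then the
polarization of a 2 × 2 determinant, and two equal summands give the factor `4 = 2²`.

Elimination needs `wᵢ ≠ 0`. If `wᵢ = 0`, every term vanishes, because Laplacians are Gram matrices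
(`principalMinor_eq_zero_of_subset`). -/

/-! ### Gram determinants -/

namespace Matrix

/-- A symmetrised form of the Cauchy–Binet formula for Gram matrices. -/
theorem factorial_mul_det_mul_transpose {m n R : Type*} [Fintype m] [DecidableEq m] [Fintype n]
    [DecidableEq n] [CommRing R] (A : Matrix m n R) :
    ((Fintype.card m).factorial : R) * (A * Aᵀ).det =
      ∑ f : m → n, (A.submatrix id f).det ^ 2 := by
  have key : (A * Aᵀ).det = ∑ f : m → n, (∏ i, A i (f i)) * (A.submatrix id f).det := by
    have h1 : A * Aᵀ = fun i => ∑ e : n, A i e • (fun j => A j e) := by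
      ext i j
      simp [Matrix.mul_apply]
    change (Matrix.detRowAlternating (R := R) (n := m)).toMultilinearMap (A * Aᵀ) = _
    rw [h1, MultilinearMap.map_sum]
    refine Finset.sum_congr rfl fun f _ => ?_
    rw [MultilinearMap.map_smul_univ, smul_eq_mul, ← Matrix.det_transpose]
    rfl
  -- Replacing `f` by `f ∘ σ` only changes the second factor by the sign of `σ`. Averaging over all
  -- `σ` turns the product of entries into a second copy of the determinant.
  have perm : ∀ σ : Equiv.Perm m, (A * Aᵀ).det =
      ∑ f : m → n, (Equiv.Perm.sign σ : ℤ) * (∏ i, A i (f (σ i))) * (A.submatrix id f).det := by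
    intro σ
    rw [key, ← (Equiv.arrowCongr σ.symm (Equiv.refl n)).sum_comp]
    refine Finset.sum_congr rfl fun f _ => ?_
    have h2 : A.submatrix id ((Equiv.arrowCongr σ.symm (Equiv.refl n)) f) =
        (A.submatrix id f).submatrix id σ := by
      ext i j; simp [Equiv.arrowCongr]
    rw [h2, Matrix.det_permute']
    simp only [Equiv.arrowCongr, Equiv.coe_fn_mk, Equiv.coe_refl, Function.comp]
    simp
    ring
  have h3 : ((Fintype.card m).factorial : R) * (A * Aᵀ).det =
      ∑ σ : Equiv.Perm m, (A * Aᵀ).det := by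
    simp [Fintype.card_perm]
  rw [h3, Finset.sum_congr rfl fun σ _ => perm σ, Finset.sum_comm]
  refine Finset.sum_congr rfl fun f _ => ?_
  rw [← Finset.sum_mul, sq]
  congr 1
  rw [← Matrix.det_transpose, Matrix.det_apply']
  rfl

/-! ### Principal minors and Schur complements -/

variable {α R : Type*} [DecidableEq α]

/-- The principal minor of `K` on the index set `W`. -/
def principalMinor [CommRing R] (K : Matrix α α R) (W : Finset α) : R :=
  (K.submatrix ((↑) : W → α) (↑)).det

theorem principalMinor_congr [CommRing R] {K K' : Matrix α α R} {W : Finset α}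
    (h : ∀ x ∈ W, ∀ y ∈ W, K x y = K' x y) : K.principalMinor W = K'.principalMinor W := by
  unfold principalMinor
  congr 1
  ext x y
  exact h x x.2 y y.2

theorem principalMinor_map [CommRing R] {S : Type*} [CommRing S] (φ : R →+* S) (K : Matrix α α R)
    (W : Finset α) : (K.map φ).principalMinor W = φ (K.principalMinor W) := by
  unfold principalMinor
  rw [RingHom.map_det]
  rfl

theorem principalMinor_reindex [CommRing R] {K K' : Matrix α α R} {W W' : Finset α} (f : α → α)
    (hf : Set.BijOn f W W') (h : ∀ x ∈ W, ∀ y ∈ W, K x y = K' (f x) (f y)) :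
    K.principalMinor W = K'.principalMinor W' := by
  unfold principalMinor
  rw [← Matrix.det_submatrix_equiv_self (hf.equiv f)]
  congr 1
  ext x y
  exact h x x.2 y y.2

theorem principalMinor_singleton [CommRing R] (K : Matrix α α R) (x : α) :
    K.principalMinor {x} = K x x := by
  unfold principalMinor
  rw [Matrix.det_unique]
  rfl

theorem principalMinor_pair [CommRing R] (K : Matrix α α R) {x y : α} (h : x ≠ y) :
    K.principalMinor {x, y} = K x x * K y y - K x y * K y x := by
  unfold principalMinor
  let f : Fin 2 → ({x, y} : Finset α) := ![⟨x, by simp⟩, ⟨y, by simp⟩]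
  have hf : Function.Bijective f := by
    constructor
    · intro i j hij
      fin_cases i <;> fin_cases j <;> simp_all [f]
    · rintro ⟨z, hz⟩
      rcases Finset.mem_insert.1 hz with rfl | hz
      · exact ⟨0, rfl⟩
      · obtain rfl := Finset.mem_singleton.1 hz
        exact ⟨1, rfl⟩
  rw [← Matrix.det_submatrix_equiv_self (Equiv.ofBijective f hf), Matrix.det_fin_two]
  rfl

/-- The Schur complement of the principal block of `K` on the index set `I`. -/
noncomputable def schurComplement [CommRing R] (K : Matrix α α R) (I : Finset α) : Matrix α α R :=
  fun x y => K x y - ∑ i : I, ∑ j : I, K x i * (K.submatrix ((↑) : I → α) (↑))⁻¹ i j * K j y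

theorem principalMinor_union [Field R] (K : Matrix α α R) {I T : Finset α} (hIT : Disjoint I T)
    (hI : K.principalMinor I ≠ 0) :
    K.principalMinor (I ∪ T) = K.principalMinor I * (K.schurComplement I).principalMinor T := by
  have hu : IsUnit (K.submatrix ((↑) : I → α) (↑)).det := isUnit_iff_ne_zero.2 hI
  let _ := Matrix.invertibleOfIsUnitDet _ hu
  unfold principalMinor
  rw [← Matrix.det_submatrix_equiv_self (Equiv.Finset.union I T hIT),
    ← Matrix.fromBlocks_toBlocks (Matrix.submatrix _ (Equiv.Finset.union I T hIT) _)]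
  have h11 : (((K.submatrix ((↑) : (I ∪ T : Finset α) → α) (↑)).submatrix
      (Equiv.Finset.union I T hIT) (Equiv.Finset.union I T hIT))).toBlocks₁₁ =
      K.submatrix ((↑) : I → α) (↑) := rfl
  rw [h11, Matrix.det_fromBlocks₁₁]
  congr 2
  ext x y
  simp only [Matrix.sub_apply, Matrix.mul_apply, Matrix.invOf_eq_nonsing_inv, schurComplement,
    Matrix.submatrix_apply, Finset.sum_mul]
  congr 1
  rw [Finset.sum_comm]
  rfl

theorem schurComplement_add [CommRing R] {K Q : Matrix α α R} {I : Finset α}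
    (h₁ : ∀ i ∈ I, ∀ x, Q i x = 0) (h₂ : ∀ i ∈ I, ∀ x, Q x i = 0) (x y : α) :
    (K + Q).schurComplement I x y = K.schurComplement I x y + Q x y := by
  have hs : (K + Q).submatrix ((↑) : I → α) ((↑) : I → α) = K.submatrix (↑) (↑) := by
    ext i j
    simp [h₁ i i.2]
  unfold schurComplement
  rw [hs]
  simp only [Matrix.add_apply]
  rw [add_sub_right_comm]
  congr 2
  refine Finset.sum_congr rfl fun i _ => Finset.sum_congr rfl fun j _ => ?_
  rw [h₁ j j.2, h₂ i i.2, add_zero, add_zero]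

theorem schurComplement_eq_self [CommRing R] {K : Matrix α α R} {I : Finset α} {x y : α}
    (h : (∀ i ∈ I, K x i = 0) ∨ ∀ i ∈ I, K i y = 0) : K.schurComplement I x y = K x y := by
  unfold schurComplement
  rw [sub_eq_self]
  refine Finset.sum_eq_zero fun i _ => Finset.sum_eq_zero fun j _ => ?_
  rcases h with h | h
  · rw [h i i.2]; ring
  · rw [h j j.2]; ring

theorem schurComplement_symm [CommRing R] {K : Matrix α α R} {I : Finset α} (h : K.IsSymm)
    (x y : α) : K.schurComplement I x y = K.schurComplement I y x := by
  have hi : ((K.submatrix ((↑) : I → α) (↑))⁻¹).IsSymm := (h.submatrix _).inv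
  unfold schurComplement
  rw [h.apply, Finset.sum_comm]
  congr 1
  refine Finset.sum_congr rfl fun i _ => Finset.sum_congr rfl fun j _ => ?_
  rw [← h.apply x j, ← h.apply y i, hi.apply]
  ring

/-- Zero row sums let the columns in `T` be traded for minus the columns in `I`, where the inverse
block cancels against the block itself. -/
theorem sum_schurComplement [Field R] {K : Matrix α α R} {I T : Finset α} (hIT : Disjoint I T)
    (hI : K.principalMinor I ≠ 0) (hK : ∀ x, ∑ y ∈ I ∪ T, K x y = 0) (x : α) :
    ∑ y ∈ T, K.schurComplement I x y = 0 := by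
  have hu : IsUnit (K.submatrix ((↑) : I → α) (↑)).det := isUnit_iff_ne_zero.2 hI
  have hT : ∀ x, ∑ y ∈ T, K x y = -∑ k : I, K x k := by
    intro x
    rw [eq_neg_iff_add_eq_zero, add_comm, Finset.sum_coe_sort I (K x), ← Finset.sum_union hIT, hK]
  unfold schurComplement
  rw [Finset.sum_sub_distrib, hT, Finset.sum_comm]
  have : ∀ i : I, ∑ y ∈ T, ∑ j : I,
      K x i * (K.submatrix ((↑) : I → α) (↑))⁻¹ i j * K j y = - K x i := by
    intro i
    rw [Finset.sum_comm]
    simp_rw [← Finset.mul_sum, hT, mul_assoc, ← Finset.mul_sum]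
    have h1 : ∀ k : I, ∑ j : I, (K.submatrix ((↑) : I → α) (↑))⁻¹ i j * K j k =
        (1 : Matrix I I R) i k := by
      intro k
      rw [← Matrix.nonsing_inv_mul _ hu, Matrix.mul_apply]
      rfl
    have h2 : ∑ j : I, (K.submatrix ((↑) : I → α) (↑))⁻¹ i j * -∑ k : I, K j k = -1 := by
      simp_rw [mul_neg, Finset.sum_neg_distrib, Finset.mul_sum]
      rw [Finset.sum_comm]
      simp_rw [h1, Matrix.one_apply]
      simp
    rw [h2, mul_neg_one]
  simp_rw [this]
  simp

/-- Over `ℚ`, a kernel vector of a Gram matrix `D Dᵀ` is already killed by `Dᵀ`. Extended by zero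
from `I` to `W`, it is still killed. -/
theorem principalMinor_eq_zero_of_subset {β : Type*} {D : α → β → ℚ} {E : Finset β}
    {K : Matrix α α ℚ} (hK : ∀ x y, K x y = ∑ e ∈ E, D x e * D y e) {I W : Finset α} (hIW : I ⊆ W)
    (hI : K.principalMinor I = 0) : K.principalMinor W = 0 := by
  have gram : ∀ X : Finset α, K.submatrix ((↑) : X → α) ((↑) : X → α) =
      (Matrix.of fun (x : X) (e : E) => D x e) * (Matrix.of fun (x : X) (e : E) => D x e)ᴴ := by
    intro X
    ext x y
    simp only [Matrix.submatrix_apply, hK, Matrix.mul_apply, Matrix.of_apply,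
      Matrix.conjTranspose_apply, star_trivial]
    exact (Finset.sum_coe_sort E (fun e => D x e * D y e)).symm
  unfold principalMinor at *
  obtain ⟨v, hv, hv0⟩ := Matrix.exists_mulVec_eq_zero_iff.2 hI
  rw [gram, Matrix.self_mul_conjTranspose_mulVec_eq_zero] at hv0
  refine Matrix.exists_mulVec_eq_zero_iff.1
    ⟨fun x => if h : (x : α) ∈ I then v ⟨x, h⟩ else 0, ?_, ?_⟩
  · contrapose! hv
    ext i
    have := congrFun hv ⟨i, hIW i.2⟩
    simpa using this
  · rw [gram, Matrix.self_mul_conjTranspose_mulVec_eq_zero]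
    ext e
    have := congrFun hv0 e
    simp only [Matrix.mulVec, dotProduct, Matrix.conjTranspose_apply, Matrix.of_apply,
      star_trivial, Pi.zero_apply] at this ⊢
    rw [Finset.sum_coe_sort W (fun x => D x e * if h : x ∈ I then v ⟨x, h⟩ else (0 : ℚ)),
      ← Finset.sum_subset hIW (fun x _ hx => by simp [hx]),
      ← Finset.sum_coe_sort I (fun x => D x e * if h : x ∈ I then v ⟨x, h⟩ else (0 : ℚ)), ← this]
    exact Finset.sum_congr rfl fun i _ => by simp

end Matrix

/-! ### Incidence matrices and trees -/

namespace Graph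

variable {α β : Type*}

/-- A path from `a` to `b` avoiding `e` is closed up by `e`. The path is found in the underlying
simple graph, which supplies distinct vertices; if `e` is a loop, the path is empty. -/
theorem exists_isCycle_of_reflTransGen {T : Graph α β} {e : β} {a b : α} (he : T.IsLink e a b)
    (h : Relation.ReflTransGen (T.deleteEdges {e}).Adj a b) :
    ∃ (n : ℕ) (v : Fin (n + 1) → α) (c : Fin (n + 1) → β), T.IsCycle v c := by
  let S : SimpleGraph α := SimpleGraph.fromRel (T.deleteEdges {e}).Adj
  have hr : S.Reachable a b := by
    clear he
    induction h with
    | refl => exact .refl _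
    | @tail x y _ hxy ih =>
      by_cases hne : x = y
      · exact hne ▸ ih
      · exact ih.trans (SimpleGraph.Adj.reachable ((SimpleGraph.fromRel_adj _ _ _).2 ⟨hne, .inl hxy⟩))
  obtain ⟨p, hp⟩ := hr.exists_isPath
  -- The edge `e` sits exactly at the last index, where `i + 1` wraps around to `0`.
  have hlink : ∀ i : Fin (p.length + 1), ∃ c, T.IsLink c (p.getVert i)
      (p.getVert (i + 1 : Fin (p.length + 1))) ∧ (c = e ↔ (i : ℕ) = p.length) := by
    intro i
    by_cases hi : (i : ℕ) = p.length
    · have : i = Fin.last _ := Fin.ext hi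
      subst this
      refine ⟨e, ?_, by simp⟩
      simpa using he.symm
    · have hlt : (i : ℕ) < p.length := by omega
      have h1 : ((i + 1 : Fin (p.length + 1)) : ℕ) = i + 1 := by
        rw [Fin.val_add_one_of_lt']; omega
      have hadj := p.adj_getVert_succ hlt
      obtain ⟨c, hc⟩ : (T.deleteEdges {e}).Adj (p.getVert i) (p.getVert (i + 1)) := by
        rcases (SimpleGraph.fromRel_adj _ _ _).1 hadj with ⟨-, h | h⟩
        · exact h
        · exact h.symm
      rw [deleteEdges_isLink] at hc
      refine ⟨c, h1 ▸ hc.1, ?_⟩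
      have : c ≠ e := hc.2
      simp [this, hi]
  choose c hc hce using hlink
  have hinj : Function.Injective fun i : Fin (p.length + 1) => p.getVert i := by
    intro i j hij
    exact Fin.ext (hp.getVert_injOn (by simpa using i.is_le) (by simpa using j.is_le) hij)
  refine ⟨p.length, fun i => p.getVert i, c, hinj, ?_, hc⟩
  intro i j hij
  by_cases hi : (i : ℕ) = p.length
  · exact Fin.ext (hi.trans ((hce j).1 (hij ▸ (hce i).2 hi)).symm)
  · have hj : (j : ℕ) ≠ p.length := fun hj => hi ((hce i).1 (hij ▸ (hce j).2 hj))
    have h1 : ∀ k : Fin (p.length + 1), (k : ℕ) ≠ p.length →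
        ((k + 1 : Fin (p.length + 1)) : ℕ) = k + 1 := by
      intro k hk
      rw [Fin.val_add_one_of_lt']; omega
    have hlj := hc j
    rw [← hij] at hlj
    -- A repeated edge with its ends swapped would force both `i = j + 1` and `j = i + 1`.
    rcases (hc i).eq_and_eq_or_eq_and_eq hlj with h | h
    · exact hinj h.1
    · have e1 := congrArg Fin.val (hinj h.1)
      have e2 := congrArg Fin.val (hinj h.2)
      rw [h1 j hj] at e1
      rw [h1 i hi] at e2
      omega

/-- `o` chooses an ordering of the two ends of every edge of `G`. -/
def IsOrientation (G : Graph α β) (o : β → α × α) : Prop :=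
  ∀ e ∈ E(G), G.IsLink e (o e).1 (o e).2

theorem exists_isOrientation [Nonempty α] (G : Graph α β) : ∃ o, G.IsOrientation o := by
  have : ∀ e, ∃ a : α × α, e ∈ E(G) → G.IsLink e a.1 a.2 := by
    intro e
    by_cases he : e ∈ E(G)
    · obtain ⟨x, y, h⟩ := G.exists_isLink_of_mem_edgeSet he
      exact ⟨(x, y), fun _ => h⟩
    · exact ⟨Classical.arbitrary _, fun h => absurd h he⟩
  choose o ho using this
  exact ⟨o, ho⟩

theorem IsOrientation.mono {G H : Graph α β} {o : β → α × α} (ho : G.IsOrientation o) (h : H ≤ G) :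
    H.IsOrientation o :=
  fun e he => (h.isLink_iff he).2 (ho e (h.edgeSet_mono he))

variable [DecidableEq α]

/-- The boundary `δ_u - δ_v` of a directed edge `(u, v)`. -/
def boundary (a : α × α) : α → ℤ := Pi.single a.1 1 - Pi.single a.2 1

theorem boundary_of_isLink {G : Graph α β} {e : β} {a : α × α} {x y : α}
    (h : G.IsLink e a.1 a.2) (h' : G.IsLink e x y) :
    ∃ ε : ℤ, ε * ε = 1 ∧ ∀ z, boundary (x, y) z = ε * boundary a z := by
  rcases h.eq_and_eq_or_eq_and_eq h' with ⟨h1, h2⟩ | ⟨h1, h2⟩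
  · exact ⟨1, by norm_num, fun z => by simp [boundary, h1, h2]⟩
  · exact ⟨-1, by norm_num, fun z => by simp [boundary, h1, h2]⟩

/-- The incidence matrix of the directed edges `o (g i)`, with rows restricted to `U`. -/
def incidence {ι : Type*} (o : β → α × α) (U : Finset α) (g : ι → β) : Matrix U ι ℤ :=
  Matrix.of fun x i => boundary (o (g i)) x

/-- A potential normalised to vanish at the root does not notice that the row of `r` is missing. -/
theorem sum_mul_boundary {U : Finset α} {r : α} {φ : α → ℤ} (hr : φ r = 0) {a : α × α}
    (h1 : a.1 ∈ insert r U) (h2 : a.2 ∈ insert r U) :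
    ∑ x : U, φ x * boundary a x = φ a.1 - φ a.2 := by
  rw [Finset.sum_coe_sort U fun x => φ x * boundary a x]
  have h3 : ∀ z ∈ insert r U, ∑ x ∈ U, φ x * (Pi.single z 1 : α → ℤ) x = φ z := by
    intro z hz
    by_cases hU : z ∈ U
    · simp [Pi.single_apply, hU]
    · obtain rfl : z = r := by simpa [hU] using hz
      simp [Pi.single_apply, hU, hr]
  simp only [boundary, Pi.sub_apply, mul_sub, Finset.sum_sub_distrib, h3 _ h1, h3 _ h2]

section

variable {T : Graph α β} {o : β → α × α} {U : Finset α} {r : α}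
  {ι : Type*} {g : ι → β}

/-- The signed edges of a walk from `r` to `x` have telescoping boundaries. These chains are the
columns of the right inverse below. -/
theorem exists_sum_boundary_eq (ho : T.IsOrientation o) [Fintype ι] [DecidableEq ι] (hg : E(T) ⊆ Set.range g) {x : α}
    (h : Relation.ReflTransGen T.Adj r x) :
    ∃ c : ι → ℤ, ∀ y, ∑ i, boundary (o (g i)) y * c i =
      (Pi.single x 1 : α → ℤ) y - (Pi.single r 1 : α → ℤ) y := by
  induction h with
  | refl => exact ⟨0, by simp⟩
  | @tail x z _ hxz ih =>
    obtain ⟨c, hc⟩ := ih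
    obtain ⟨e, he⟩ := hxz
    obtain ⟨i, rfl⟩ := hg he.edge_mem
    obtain ⟨ε, -, hε⟩ := boundary_of_isLink (ho _ he.edge_mem) he.symm
    refine ⟨c + Pi.single i ε, fun y => ?_⟩
    have : ∑ j, boundary (o (g j)) y * (Pi.single i ε : ι → ℤ) j = boundary (z, x) y := by
      rw [hε]
      simp [Pi.single_apply, mul_comm]
    simp only [Pi.add_apply, mul_add, Finset.sum_add_distrib, hc, this]
    simp [boundary]

theorem exists_incidence_mul_eq_one (ho : T.IsOrientation o) [Fintype ι] [DecidableEq ι] (hg : E(T) ⊆ Set.range g)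
    (hr : r ∉ U) (h : ∀ x ∈ U, Relation.ReflTransGen T.Adj r x) :
    ∃ N : Matrix ι U ℤ, incidence o U g * N = 1 := by
  choose c hc using fun x : U => exists_sum_boundary_eq ho hg (h x x.2)
  refine ⟨Matrix.of fun i x => c x i, ?_⟩
  ext y x
  have hyr : (y : α) ≠ r := fun h => hr (h ▸ y.2)
  simp only [Matrix.mul_apply, incidence, Matrix.of_apply, hc]
  rw [Pi.single_eq_of_ne hyr, sub_zero, Pi.single_apply, Matrix.one_apply]
  simp only [Subtype.ext_iff]

theorem exists_mul_incidence_eq_one (ho : T.IsOrientation o) [Fintype ι] [DecidableEq ι] (hgi : Function.Injective g)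
    (hg : ∀ i, g i ∈ E(T)) (hU : (insert r U : Finset α) = V(T))
    (hc : ∀ (n : ℕ) (v : Fin (n + 1) → α) (e : Fin (n + 1) → β), ¬ T.IsCycle v e) :
    ∃ N : Matrix ι U ℤ, N * incidence o U g = 1 := by
  classical
  have hmem : ∀ x ∈ V(T), x ∈ insert r U := fun x hx => by rwa [← Finset.mem_coe, hU]
  have key : ∀ i, ∃ φ : α → ℤ, φ r = 0 ∧ ∀ j,
      φ (o (g j)).1 - φ (o (g j)).2 = if i = j then 1 else 0 := by
    intro i
    -- Row `i` of the left inverse is the indicator of one side of the cut obtained by deleting edge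
    -- `i`, shifted to vanish at `r`. Without cycles, edge `i` is the only one crossing the cut.
    let S := Relation.ReflTransGen (T.deleteEdges {g i}).Adj (o (g i)).1
    let ψ : α → ℤ := fun x => if S x then 1 else 0
    refine ⟨fun x => ψ x - ψ r, sub_self _, fun j => ?_⟩
    rw [sub_sub_sub_cancel_right]
    by_cases hij : i = j
    · subst hij
      have h1 : S (o (g i)).1 := .refl
      have h2 : ¬ S (o (g i)).2 := fun h => by
        obtain ⟨n, v, c, h⟩ := exists_isCycle_of_reflTransGen (ho _ (hg i)) h
        exact hc n v c h
      simp [ψ, h1, h2]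
    · have hadj : (T.deleteEdges {g i}).Adj (o (g j)).1 (o (g j)).2 :=
        ⟨g j, by
          rw [deleteEdges_isLink]
          exact ⟨ho _ (hg j), fun h => hij (hgi h).symm⟩⟩
      have : S (o (g j)).1 ↔ S (o (g j)).2 := ⟨fun h => h.tail hadj, fun h => h.tail hadj.symm⟩
      simp [ψ, this, hij]
  choose φ hφr hφ using key
  refine ⟨Matrix.of fun i x => φ i x, ?_⟩
  ext i j
  simp only [Matrix.mul_apply, incidence, Matrix.of_apply]
  rw [sum_mul_boundary (hφr i) (hmem _ (ho _ (hg j)).left_mem) (hmem _ (ho _ (hg j)).right_mem),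
    hφ, Matrix.one_apply]

theorem exists_vecMul_incidence_eq_zero (ho : T.IsOrientation o) (hg : ∀ i, g i ∈ E(T))
    (hU : (insert r U : Finset α) = V(T)) (hT : ¬ T.IsConnected) :
    ∃ w : U → ℤ, w ≠ 0 ∧ Matrix.vecMul w (incidence o U g) = 0 := by
  classical
  have hmem : ∀ x ∈ V(T), x ∈ insert r U := fun x hx => by rwa [← Finset.mem_coe, hU]
  have hrV : r ∈ V(T) := by rw [← hU]; simp
  obtain ⟨x, hx, hrx⟩ : ∃ x ∈ V(T), ¬ Relation.ReflTransGen T.Adj r x := by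
    by_contra! h
    refine hT ⟨⟨r, hrV⟩, fun x hx y hy => ?_⟩
    exact (Std.Symm.symm _ _ (h x hx)).trans (h y hy)
  -- The indicator of the vertices not reachable from `r` is constant along edges.
  let φ : α → ℤ := fun x => if Relation.ReflTransGen T.Adj r x then 0 else 1
  have hφ : φ r = 0 := if_pos .refl
  refine ⟨fun x => φ x, ?_, ?_⟩
  · intro h
    have hxU : x ∈ U := by
      rcases Finset.mem_insert.1 (hmem x hx) with rfl | h
      · exact absurd .refl hrx
      · exact h
    have := congrFun h ⟨x, hxU⟩
    simp [φ, hrx] at this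
  · ext i
    have hl := ho _ (hg i)
    simp only [Matrix.vecMul, dotProduct, incidence, Matrix.of_apply]
    rw [sum_mul_boundary hφ (hmem _ hl.left_mem) (hmem _ hl.right_mem)]
    have : Relation.ReflTransGen T.Adj r (o (g i)).1 ↔ Relation.ReflTransGen T.Adj r (o (g i)).2 :=
      ⟨fun h => h.tail hl.adj, fun h => h.tail hl.symm.adj⟩
    simp [φ, this]

theorem exists_incidence_mulVec_eq_zero (ho : T.IsOrientation o) [Fintype ι] [DecidableEq ι] (hg : E(T) ⊆ Set.range g)
    {n : ℕ} {v : Fin (n + 1) → α} {e : Fin (n + 1) → β} (hc : T.IsCycle v e) :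
    ∃ c : ι → ℤ, c ≠ 0 ∧ Matrix.mulVec (incidence o U g) c = 0 := by
  obtain ⟨-, hei, hl⟩ := hc
  choose k hk using fun i => hg (hl i).edge_mem
  have hki : Function.Injective k := fun i j h => hei (by rw [← hk, ← hk, h])
  choose ε hε hb using fun i => boundary_of_isLink (ho _ (hl i).edge_mem) (hl i)
  -- The edges of the cycle, signed by its direction, have total boundary zero. The vector is
  -- nonzero because these edges are distinct.
  refine ⟨∑ j, Pi.single (k j) (ε j), ?_, ?_⟩
  · intro h
    have h0 := congrFun h (k 0)
    simp only [Finset.sum_apply, Pi.single_apply, hki.eq_iff, Pi.zero_apply] at h0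
    have h1 := hε 0
    simp at h0
    simp [h0] at h1
  · ext x
    have h1 : ∀ j, Matrix.mulVec (incidence o U g) (Pi.single (k j) (ε j)) x =
        (Pi.single (v j) 1 : α → ℤ) x - (Pi.single (v (j + 1)) 1 : α → ℤ) x := by
      intro j
      have := hb j x
      rw [Matrix.mulVec_single]
      simp only [boundary, Pi.sub_apply] at this
      rw [this]
      simp [incidence, hk, boundary, mul_comm]
    have h2 : ∑ j, (Pi.single (v (j + 1)) 1 : α → ℤ) x = ∑ j, (Pi.single (v j) 1 : α → ℤ) x :=
      Equiv.sum_comp (Equiv.addRight (1 : Fin (n + 1))) fun j => (Pi.single (v j) 1 : α → ℤ) x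
    rw [Matrix.mulVec_sum, Finset.sum_apply, Finset.sum_congr rfl fun j _ => h1 j,
      Finset.sum_sub_distrib, h2, sub_self, Pi.zero_apply]

end

end Graph

/-! ### The matrix-tree theorem -/

namespace Graph

variable {α β : Type*}

theorem numSpanningTrees_eq_card {G : Graph α β} {E : Finset β} (hE : (E : Set β) = E(G))
    [DecidablePred fun F : Finset β => (G.restrict F).IsTree] :
    G.numSpanningTrees = (E.powerset.filter fun F : Finset β => (G.restrict (F : Set β)).IsTree).card := by
  have h1 : {T : Graph α β | T ≤s G ∧ T.IsTree} = (fun F : Finset β => G.restrict (F : Set β)) ''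
      (E.powerset.filter fun F : Finset β => (G.restrict (F : Set β)).IsTree : Finset (Finset β)) := by
    ext T
    simp only [Set.mem_ofPred_eq, Set.mem_image, Finset.mem_coe, Finset.mem_filter,
      Finset.mem_powerset]
    constructor
    · rintro ⟨hT, htree⟩
      have hTE : E(T) ⊆ E := hE ▸ hT.le.edgeSet_mono
      have hF : ((E.finite_toSet.subset hTE).toFinset : Set β) = E(T) := by simp
      have hT' : G.restrict E(T) = T := by
        refine Graph.ext hT.vertexSet_eq.symm fun e x y => ?_
        rw [restrict_isLink]
        exact ⟨fun h => (hT.le.isLink_iff h.1).2 h.2, fun h => ⟨h.edge_mem, h.mono hT.le⟩⟩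
      refine ⟨(E.finite_toSet.subset hTE).toFinset, ⟨?_, ?_⟩, ?_⟩
      · rw [← Finset.coe_subset, hF]
        exact hTE
      · rwa [hF, hT']
      · rw [hF, hT']
    · rintro ⟨F, ⟨-, hF⟩, rfl⟩
      exact ⟨⟨restrict_le, rfl⟩, hF⟩
  unfold numSpanningTrees
  rw [h1, Set.InjOn.ncard_image, Set.ncard_coe_finset]
  intro F hF F' hF' h
  have hsub : ∀ {F : Finset β}, F ∈ (E.powerset.filter fun F : Finset β =>
      (G.restrict (F : Set β)).IsTree : Finset (Finset β)) → E(G.restrict (F : Set β)) = F := by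
    intro F hF
    rw [edgeSet_restrict, Set.inter_eq_right, ← hE, Finset.coe_subset]
    exact Finset.mem_powerset.1 (Finset.mem_filter.1 hF).1
  have h2 := congrArg Graph.edgeSet h
  simp only at h2
  rw [hsub hF, hsub hF'] at h2
  exact Finset.coe_injective h2

variable [DecidableEq α]

/-- The Laplacian matrix of the directed edges `o e` with `e ∈ E`. -/
def laplacian (o : β → α × α) (E : Finset β) : Matrix α α ℤ :=
  Matrix.of fun x y => ∑ e ∈ E, boundary (o e) x * boundary (o e) y

theorem reflTransGen_of_isConnected {T : Graph α β} (hT : T.IsConnected) {U : Finset α} {r : α}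
    (hU : (insert r U : Finset α) = V(T)) : ∀ x ∈ U, Relation.ReflTransGen T.Adj r x := by
  refine fun x hx => hT.2 r ?_ x ?_ <;> rw [← hU] <;> simp [hx]

/-- Connectedness gives the reduced incidence matrix a right inverse and acyclicity a left inverse,
so it is square. -/
theorem card_eq_of_isTree {T : Graph α β} {o : β → α × α} (ho : T.IsOrientation o) {U : Finset α}
    {r : α} (hr : r ∉ U) (hU : (insert r U : Finset α) = V(T)) (hT : T.IsTree) {F : Finset β}
    (hF : (F : Set β) = E(T)) : U.card = F.card := by
  classical
  obtain ⟨N, hN⟩ := exists_incidence_mul_eq_one (g := ((↑) : F → β)) ho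
    (by rw [Subtype.range_coe]; exact hF.ge) hr (reflTransGen_of_isConnected hT.1 hU)
  obtain ⟨M, hM⟩ := exists_mul_incidence_eq_one (g := ((↑) : F → β)) ho Subtype.val_injective
    (fun i => hF ▸ i.2) hU hT.2
  have hMN : M = N := by rw [← Matrix.mul_one M, ← hN, ← Matrix.mul_assoc, hM, Matrix.one_mul]
  simpa using Matrix.square_of_invertible _ _ hN (hMN ▸ hM)

/-- For a tree the matrix is invertible over `ℤ`, so its determinant is `±1`. Otherwise a cycle
gives a right kernel vector, or disconnectedness a left one. -/
theorem sq_det_incidence {T : Graph α β} {o : β → α × α} (ho : T.IsOrientation o) {U : Finset α}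
    {r : α} (hr : r ∉ U) (hU : (insert r U : Finset α) = V(T)) {g : U → β}
    (hg : Set.range g = E(T)) [Decidable T.IsTree] :
    (incidence o U g).det ^ 2 = if T.IsTree then 1 else 0 := by
  split_ifs with hT
  · obtain ⟨N, hN⟩ := exists_incidence_mul_eq_one (g := g) ho hg.ge hr
      (reflTransGen_of_isConnected hT.1 hU)
    have : IsUnit (incidence o U g).det := by
      refine IsUnit.of_mul_eq_one N.det ?_
      rw [← Matrix.det_mul, hN, Matrix.det_one]
    rcases Int.isUnit_iff.1 this with h | h <;> simp [h]
  · rw [sq_eq_zero_iff]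
    by_cases hc : T.IsConnected
    · have : ∃ (n : ℕ) (v : Fin (n + 1) → α) (e : Fin (n + 1) → β), T.IsCycle v e := by
        by_contra! h
        exact hT ⟨hc, h⟩
      obtain ⟨n, v, e, h⟩ := this
      exact Matrix.exists_mulVec_eq_zero_iff.1 (exists_incidence_mulVec_eq_zero ho hg.ge h)
    · exact Matrix.exists_vecMul_eq_zero_iff.1
        (exists_vecMul_incidence_eq_zero ho (fun i => hg ▸ Set.mem_range_self i) hU hc)

/-- These maps are the bijections from `m` to `F`; their number cancels the factorial in the
symmetrised Cauchy–Binet formula. -/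
theorem card_injective_image_eq {m : Type*} [Fintype m] [DecidableEq m] [DecidableEq β]
    {E F : Finset β} (hFE : F ⊆ E) (h : Fintype.card m = F.card) :
    (Finset.univ.filter fun f : m → E => Function.Injective f ∧
      Finset.univ.image (fun x => (f x : β)) = F).card = (Fintype.card m).factorial := by
  have e : m ≃ F := Fintype.equivOfCardEq (by simpa using h)
  rw [← Fintype.card_equiv e, ← Finset.card_univ]
  symm
  refine Finset.card_bij (fun σ _ x => ⟨σ x, hFE (σ x).2⟩) ?_ ?_ ?_
  · intro σ _
    rw [Finset.mem_filter]
    refine ⟨Finset.mem_univ _, fun x y hxy => σ.injective (Subtype.ext ?_), ?_⟩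
    · simpa using hxy
    · ext b
      simp only [Finset.mem_image, Finset.mem_univ, true_and]
      exact ⟨fun ⟨x, hx⟩ => hx ▸ (σ x).2, fun hb => ⟨σ.symm ⟨b, hb⟩, by simp⟩⟩
  · intro σ _ τ _ hστ
    ext x
    simpa using congrArg Subtype.val (congrFun hστ x)
  · intro f hf
    obtain ⟨-, hinj, him⟩ := Finset.mem_filter.1 hf
    have hmem : ∀ x, (f x : β) ∈ F := fun x => him ▸ Finset.mem_image_of_mem _ (Finset.mem_univ x)
    have hbij : Function.Bijective fun x => (⟨f x, hmem x⟩ : F) := by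
      refine ⟨fun x y hxy => hinj (Subtype.ext (Subtype.mk.inj hxy)), fun ⟨b, hb⟩ => ?_⟩
      rw [← him] at hb
      obtain ⟨x, -, hx⟩ := Finset.mem_image.1 hb
      exact ⟨x, Subtype.ext hx⟩
    exact ⟨Equiv.ofBijective _ hbij, Finset.mem_univ _, rfl⟩

/-- The matrix-tree theorem. -/
theorem numSpanningTrees_eq_principalMinor {G : Graph α β} {o : β → α × α} (ho : G.IsOrientation o)
    {U : Finset α} {r : α} (hr : r ∉ U) (hU : (insert r U : Finset α) = V(G)) {E : Finset β}
    (hE : (E : Set β) = E(G)) :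
    (G.numSpanningTrees : ℤ) = (laplacian o E).principalMinor U := by
  classical
  set 𝒯 := E.powerset.filter fun F : Finset β => (G.restrict (F : Set β)).IsTree with h𝒯
  have hgram : (laplacian o E).submatrix ((↑) : U → α) (↑) =
      incidence o U ((↑) : E → β) * (incidence o U ((↑) : E → β)).transpose := by
    ext x y
    exact (Finset.sum_coe_sort E fun e => boundary (o e) x * boundary (o e) y).symm
  have hdet : ∀ f : U → E, ((incidence o U ((↑) : E → β)).submatrix id f).det ^ 2 =
      if Function.Injective f ∧ Finset.univ.image (fun x => (f x : β)) ∈ 𝒯 then 1 else 0 := by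
    intro f
    by_cases hf : Function.Injective f
    · set F := Finset.univ.image (fun x => (f x : β)) with hF
      have hFE : F ⊆ E := by
        intro b hb
        obtain ⟨x, -, rfl⟩ := Finset.mem_image.1 hb
        exact (f x).2
      have hrange : Set.range (fun x => (f x : β)) = E(G.restrict (F : Set β)) := by
        rw [edgeSet_restrict, Set.inter_eq_right.2 (by rwa [← hE, Finset.coe_subset]), hF]
        simp
      have := sq_det_incidence (ho.mono (restrict_le (E₀ := (F : Set β)))) hr hU hrange
      have hsub : (incidence o U ((↑) : E → β)).submatrix id f = incidence o U fun x => f x := rfl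
      rw [hsub, this]
      simp [hf, h𝒯, hFE]
    · simp only [hf, false_and, if_false, sq_eq_zero_iff]
      unfold Function.Injective at hf
      push Not at hf
      obtain ⟨x, y, hxy, hne⟩ := hf
      exact Matrix.det_zero_of_column_eq hne fun z => by simp [hxy]
  have hcard : (Finset.univ.filter fun f : U → E => Function.Injective f ∧
      Finset.univ.image (fun x => (f x : β)) ∈ 𝒯).card =
      𝒯.card * (Fintype.card U).factorial := by
    rw [Finset.card_eq_sum_card_fiberwise (t := 𝒯)
      (f := fun f : U → E => Finset.univ.image fun x => (f x : β))
      (fun f hf => (Finset.mem_filter.1 hf).2.2)]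
    refine Finset.sum_const_nat fun F hF => ?_
    obtain ⟨hFE, hFt⟩ := Finset.mem_filter.1 hF
    rw [Finset.mem_powerset] at hFE
    have hFc : (F : Set β) = E(G.restrict (F : Set β)) := by
      rw [edgeSet_restrict, Set.inter_eq_right.2 (by rwa [← hE, Finset.coe_subset])]
    rw [← card_injective_image_eq hFE (by
      simpa using card_eq_of_isTree (ho.mono restrict_le) hr hU hFt hFc), Finset.filter_filter]
    congr 1
    ext f
    simp only [Finset.mem_filter, Finset.mem_univ, true_and]
    constructor
    · rintro ⟨⟨h1, -⟩, h2⟩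
      exact ⟨h1, h2⟩
    · rintro ⟨h1, h2⟩
      exact ⟨⟨h1, h2 ▸ hF⟩, h2⟩
  have hmain := Matrix.factorial_mul_det_mul_transpose (incidence o U ((↑) : E → β))
  rw [Finset.sum_congr rfl fun f _ => hdet f, Finset.sum_boole, hcard, ← hgram] at hmain
  rw [numSpanningTrees_eq_card hE, Matrix.principalMinor]
  push_cast at hmain
  rw [mul_comm] at hmain
  exact (mul_right_cancel₀ (by exact_mod_cast Nat.factorial_ne_zero _) hmain).symm

/-- The matrix-tree theorem for a graph in which the vertices of `S` are identified. -/
theorem numSpanningTrees_identify {G : Graph α β} {o : β → α × α} (ho : G.IsOrientation o)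
    {W S : Finset α} {r : α} (hr : r ∈ S) (hWS : Disjoint W S) (hW : (W ∪ S : Finset α) = V(G))
    {E : Finset β} (hE : (E : Set β) = E(G)) :
    ((G.identify S r).numSpanningTrees : ℤ) = (laplacian o E).principalMinor W := by
  classical
  let f : α → α := fun x => if x ∈ S then r else x
  have hf : G.identify S r = G.map f := by
    unfold identify
    congr 1
    ext x
    simp [f]
  have hfo : (G.map f).IsOrientation fun e => (f (o e).1, f (o e).2) :=
    fun e he => (ho e he).map f
  have hrW : r ∉ W := fun h => Finset.disjoint_left.1 hWS h hr
  have hV : (insert r W : Finset α) = V(G.map f) := by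
    rw [vertexSet_map, ← hW, ← Finset.coe_image, Finset.image_union]
    congr 1
    ext x
    simp only [Finset.mem_insert, Finset.mem_union, Finset.mem_image, f]
    constructor
    · rintro (rfl | h)
      · exact .inr ⟨x, hr, if_pos hr⟩
      · exact .inl ⟨x, h, if_neg (Finset.disjoint_left.1 hWS h)⟩
    · rintro (⟨y, hy, h⟩ | ⟨y, hy, h⟩)
      · rw [if_neg (Finset.disjoint_left.1 hWS hy)] at h
        exact .inr (h ▸ hy)
      · rw [if_pos hy] at h
        exact .inl h.symm
  rw [hf, numSpanningTrees_eq_principalMinor hfo hrW hV (E := E) (by simpa using hE)]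
  -- Identification moves only vertices of `S`, so the incidence rows at vertices of `W` do not
  -- change.
  have hb : ∀ a : α × α, ∀ x ∈ W, boundary (f a.1, f a.2) x = boundary a x := by
    intro a x hx
    have hxS := Finset.disjoint_left.1 hWS hx
    have h1 : ∀ z, (Pi.single (f z) 1 : α → ℤ) x = (Pi.single z 1 : α → ℤ) x := by
      intro z
      simp only [f, Pi.single_apply]
      split_ifs <;> grind
    simp only [boundary, Pi.sub_apply, h1]
  refine Matrix.principalMinor_congr fun x hx y hy => ?_
  simp only [laplacian, Matrix.of_apply]
  exact Finset.sum_congr rfl fun e _ => by rw [hb _ x hx, hb _ y hy]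

end Graph

/-! ### Reduction to three terminals and gluing -/

namespace Matrix

variable {α : Type*} [DecidableEq α] {R : Type*} [Field R]

/-- Principal minors of a matrix with vanishing row sums, in terms of its Schur complement on three
remaining indices. -/
theorem principalMinor_three {K : Matrix α α R} {I : Finset α} {p q s : α} (hpq : p ≠ q)
    (hps : p ≠ s) (hqs : q ≠ s) (hI : Disjoint I {p, q, s}) (hK : K.IsSymm)
    (hsum : ∀ x, ∑ y ∈ I ∪ {p, q, s}, K x y = 0) (hw : K.principalMinor I ≠ 0) :
    K.principalMinor (I ∪ {p, q}) = K.principalMinor I *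
      (K.schurComplement I p p * K.schurComplement I q q - K.schurComplement I p q ^ 2) ∧
    K.principalMinor (I ∪ {q}) = K.principalMinor I * K.schurComplement I q q ∧
    K.principalMinor (I ∪ {s}) = K.principalMinor I *
      (K.schurComplement I p p + 2 * K.schurComplement I p q + K.schurComplement I q q) ∧
    K.principalMinor (I ∪ {p}) = K.principalMinor I * K.schurComplement I p p := by
  have hd : ∀ T ⊆ ({p, q, s} : Finset α), Disjoint I T :=
    fun T hT => Finset.disjoint_of_subset_right hT hI
  have hrow : ∀ x, K.schurComplement I x p + (K.schurComplement I x q + K.schurComplement I x s)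
      = 0 := by
    intro x
    rw [← sum_schurComplement hI hw hsum x, Finset.sum_insert (by simp [hpq, hps]),
      Finset.sum_pair hqs]
  rw [principalMinor_union K (hd {p, q} (by grind)) hw,
    principalMinor_union K (hd {q} (by grind)) hw, principalMinor_union K (hd {s} (by grind)) hw,
    principalMinor_union K (hd {p} (by grind)) hw, principalMinor_pair _ hpq,
    principalMinor_singleton, principalMinor_singleton, principalMinor_singleton]
  have h1 := schurComplement_symm (I := I) hK q p
  have h2 := schurComplement_symm (I := I) hK s p
  have h3 := schurComplement_symm (I := I) hK s q
  refine ⟨by rw [h1]; ring, rfl, ?_, rfl⟩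
  -- The three zero row sums express the diagonal entry at `s` through the entries at `p` and `q`.
  have r1 := hrow p
  have r2 := hrow q
  have r3 := hrow s
  rw [h1] at r2
  rw [h2, h3] at r3
  congr 1
  linear_combination r3 - r1 - r2

/-- `I` is eliminated first, then `J`. Since `Q` vanishes on `I` and `K` on `J`, each elimination
leaves the other summand unchanged, and the Schur complements on `T` add like networks in parallel.
-/
theorem principalMinor_add_union {K Q : Matrix α α R} {I J T : Finset α}
    (hIJ : Disjoint I (J ∪ T)) (hJT : Disjoint J T) (hK : K.IsSymm) (hQ : Q.IsSymm)
    (hKJ : ∀ i ∈ J, ∀ x, K i x = 0) (hQI : ∀ i ∈ I, ∀ x, Q i x = 0)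
    (hI : K.principalMinor I ≠ 0) (hJ : Q.principalMinor J ≠ 0) :
    (K + Q).principalMinor (I ∪ (J ∪ T)) = K.principalMinor I * (Q.principalMinor J *
      (K.schurComplement I + Q.schurComplement J).principalMinor T) := by
  have h1 : (K + Q).principalMinor I = K.principalMinor I :=
    principalMinor_congr fun x hx y _ => by rw [Matrix.add_apply, hQI x hx, add_zero]
  have hKJ' : ∀ i ∈ J, ∀ x, K.schurComplement I i x = 0 := fun i hi x => by
    rw [schurComplement_eq_self (.inl fun k _ => hKJ i hi k), hKJ i hi]
  have h2 : (K + Q).schurComplement I = Q + K.schurComplement I := by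
    ext x y
    rw [schurComplement_add hQI (fun i hi x => by rw [← hQ.apply, hQI i hi]), Matrix.add_apply,
      add_comm]
  have h3 : (Q + K.schurComplement I).principalMinor J = Q.principalMinor J :=
    principalMinor_congr fun x hx y _ => by rw [Matrix.add_apply, hKJ' x hx, add_zero]
  rw [principalMinor_union _ hIJ (h1 ▸ hI), h1, h2, principalMinor_union _ hJT (h3 ▸ hJ), h3]
  congr 2
  refine principalMinor_congr fun x _ y _ => ?_
  rw [schurComplement_add hKJ' (fun i hi x => by rw [schurComplement_symm hK, hKJ' i hi]),
    Matrix.add_apply, add_comm]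

end Matrix

/-! ### Rational Laplacians -/

namespace Graph

variable {α β : Type*} [DecidableEq α]

/-- The Laplacian matrix with rational entries. -/
def ratLaplacian (o : β → α × α) (E : Finset β) : Matrix α α ℚ :=
  (laplacian o E).map (Int.castRingHom ℚ)

theorem ratLaplacian_apply (o : β → α × α) (E : Finset β) (x y : α) :
    ratLaplacian o E x y = ∑ e ∈ E, (boundary (o e) x : ℚ) * (boundary (o e) y : ℚ) := by
  simp [ratLaplacian, laplacian]

theorem ratLaplacian_isSymm (o : β → α × α) (E : Finset β) : (ratLaplacian o E).IsSymm := by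
  ext x y
  simp only [Matrix.transpose_apply, ratLaplacian_apply, mul_comm]

theorem boundary_eq_zero {a : α × α} {x : α} (h1 : a.1 ≠ x) (h2 : a.2 ≠ x) : boundary a x = 0 := by
  simp [boundary, h1.symm, h2.symm]

theorem sum_boundary {a : α × α} {V : Finset α} (h1 : a.1 ∈ V) (h2 : a.2 ∈ V) :
    ∑ x ∈ V, boundary a x = 0 := by
  simp [boundary, Finset.sum_sub_distrib, Pi.single_apply, h1, h2]

section

variable {G : Graph α β} {o : β → α × α} {E : Finset β}

theorem ratLaplacian_eq_zero (ho : G.IsOrientation o) (hE : (E : Set β) = E(G)) {x : α}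
    (hx : x ∉ V(G)) (y : α) : ratLaplacian o E x y = 0 := by
  rw [ratLaplacian_apply]
  refine Finset.sum_eq_zero fun e he => ?_
  have hl := ho e (hE ▸ he)
  have : boundary (o e) x = 0 := boundary_eq_zero (ne_of_mem_of_not_mem hl.left_mem hx)
    (ne_of_mem_of_not_mem hl.right_mem hx)
  rw [this, Int.cast_zero, zero_mul]

theorem sum_ratLaplacian (ho : G.IsOrientation o) (hE : (E : Set β) = E(G)) {V : Finset α}
    (hV : (V : Set α) = V(G)) (x : α) : ∑ y ∈ V, ratLaplacian o E x y = 0 := by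
  simp only [ratLaplacian_apply]
  rw [Finset.sum_comm]
  refine Finset.sum_eq_zero fun e he => ?_
  have hl := ho e (hE ▸ he)
  have := sum_boundary (Finset.mem_coe.1 (hV ▸ hl.left_mem)) (Finset.mem_coe.1 (hV ▸ hl.right_mem))
  rw [← Finset.mul_sum, ← Int.cast_sum, this]
  simp

theorem numSpanningTrees_eq_ratLaplacian (ho : G.IsOrientation o) (hE : (E : Set β) = E(G))
    {U : Finset α} {r : α} (hr : r ∉ U) (hU : (insert r U : Finset α) = V(G)) :
    (G.numSpanningTrees : ℚ) = (ratLaplacian o E).principalMinor U := by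
  rw [ratLaplacian, Matrix.principalMinor_map, ← numSpanningTrees_eq_principalMinor ho hr hU hE]
  simp

theorem numSpanningTrees_identify_eq_ratLaplacian (ho : G.IsOrientation o)
    (hE : (E : Set β) = E(G)) {W S : Finset α} {r : α} (hr : r ∈ S) (hWS : Disjoint W S)
    (hW : (W ∪ S : Finset α) = V(G)) :
    ((G.identify S r).numSpanningTrees : ℚ) = (ratLaplacian o E).principalMinor W := by
  rw [ratLaplacian, Matrix.principalMinor_map, ← numSpanningTrees_identify ho hr hWS hW hE]
  simp

/-- The numbers of spanning trees of a graph and of its identifications at three vertices, as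
principal minors of one matrix. -/
theorem numSpanningTrees_three (ho : G.IsOrientation o) (hE : (E : Set β) = E(G)) {I : Finset α}
    {p q s : α} (hpq : p ≠ q) (hps : p ≠ s) (hqs : q ≠ s) (hI : Disjoint I {p, q, s})
    (hV : (I ∪ {p, q, s} : Finset α) = V(G)) :
    (G.numSpanningTrees : ℚ) = (ratLaplacian o E).principalMinor (I ∪ {p, q}) ∧
    ((G.identify {p, q, s} p).numSpanningTrees : ℚ) = (ratLaplacian o E).principalMinor I ∧
    ((G.identify {p, s} p).numSpanningTrees : ℚ) = (ratLaplacian o E).principalMinor (I ∪ {q}) ∧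
    ((G.identify {p, q} p).numSpanningTrees : ℚ) = (ratLaplacian o E).principalMinor (I ∪ {s}) ∧
    ((G.identify {q, s} q).numSpanningTrees : ℚ) =
      (ratLaplacian o E).principalMinor (I ∪ {p}) := by
  have hd : ∀ x ∈ I, x ≠ p ∧ x ≠ q ∧ x ≠ s := fun x hx => by
    simpa using Finset.disjoint_left.1 hI hx
  refine ⟨?_, ?_, ?_, ?_, ?_⟩
  · exact numSpanningTrees_eq_ratLaplacian ho hE (r := s) (by grind)
      (by rw [← hV]; congr 1; grind)
  · simpa using numSpanningTrees_identify_eq_ratLaplacian ho hE (S := {p, q, s}) (r := p)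
      (by simp) hI hV
  · simpa using numSpanningTrees_identify_eq_ratLaplacian ho hE (W := I ∪ {q}) (S := {p, s})
      (r := p) (by simp) (by rw [Finset.disjoint_left]; grind) (by rw [← hV]; congr 1; grind)
  · simpa using numSpanningTrees_identify_eq_ratLaplacian ho hE (W := I ∪ {s}) (S := {p, q})
      (r := p) (by simp) (by rw [Finset.disjoint_left]; grind) (by rw [← hV]; congr 1; grind)
  · simpa using numSpanningTrees_identify_eq_ratLaplacian ho hE (W := I ∪ {p}) (S := {q, s})
      (r := q) (by simp) (by rw [Finset.disjoint_left]; grind) (by rw [← hV]; congr 1; grind)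

end

/-- The isomorphism need not respect the orientation, but a reversed edge contributes its sign twice
to each Laplacian entry. -/
theorem ratLaplacian_copy {G H : Graph α β} {o : β → α × α} (hoG : G.IsOrientation o)
    (hoH : H.IsOrientation o) {E F : Finset β} (hE : (E : Set β) = E(G)) (hF : (F : Set β) = E(H))
    {f : α → α} {g : β → β} (hf : Set.InjOn f V(G)) (hg : Set.BijOn g E(G) E(H))
    (hfg : ∀ e ∈ E(G), ∀ x ∈ V(G), ∀ y ∈ V(G), G.IsLink e x y ↔ H.IsLink (g e) (f x) (f y))
    {x y : α} (hx : x ∈ V(G)) (hy : y ∈ V(G)) :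
    ratLaplacian o E x y = ratLaplacian o F (f x) (f y) := by
  rw [ratLaplacian_apply, ratLaplacian_apply]
  rw [← hE, ← hF] at hg
  refine Finset.sum_nbij g hg.mapsTo hg.injOn hg.surjOn fun e he => ?_
  have heG : e ∈ E(G) := hE ▸ he
  have hl := hoG e heG
  have hl' := (hfg e heG _ hl.left_mem _ hl.right_mem).1 hl
  obtain ⟨ε, hε, hb⟩ := boundary_of_isLink (hoH _ hl'.edge_mem) hl'
  have hbf : ∀ z ∈ V(G), boundary (f (o e).1, f (o e).2) (f z) = boundary (o e) z := by
    intro z hz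
    simp only [boundary, Pi.sub_apply, Pi.single_apply, hf.eq_iff hz hl.left_mem,
      hf.eq_iff hz hl.right_mem]
  rw [← hbf x hx, ← hbf y hy, hb, hb]
  push_cast
  have : (ε : ℚ) * ε = 1 := by exact_mod_cast hε
  linear_combination (boundary (o (g e)) (f x) : ℚ) * boundary (o (g e)) (f y) * this

end Graph

/-! ### The gluing formula -/

theorem mainTheorem10 {α β : Type*} (G G₁ G₂ : Graph α β) (p q s : α)
    (hV : V(G).Finite) (hE : E(G).Finite)
    (hpq : p ≠ q) (hps : p ≠ s) (hqs : q ≠ s)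
    (hG : G.IsUnionAlong G₁ G₂ {p, q, s}) :
    (∀ a₁ b₁ c₁ a₂ b₂ c₂ : ℚ,
      a₁ = (G₁.identify {p, s} p).numSpanningTrees →
      b₁ = (G₁.identify {p, q} p).numSpanningTrees →
      c₁ = (G₁.identify {q, s} q).numSpanningTrees →
      a₂ = (G₂.identify {p, s} p).numSpanningTrees →
      b₂ = (G₂.identify {p, q} p).numSpanningTrees →
      c₂ = (G₂.identify {q, s} q).numSpanningTrees →
      (G.numSpanningTrees : ℚ) =
        G₁.numSpanningTrees * (G₂.identify {p, q, s} p).numSpanningTrees +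
        G₂.numSpanningTrees * (G₁.identify {p, q, s} p).numSpanningTrees +
        1 / 2 * (a₁ * (-a₂ + b₂ + c₂) + b₁ * (a₂ - b₂ + c₂) + c₁ * (a₂ + b₂ - c₂))) ∧
    (G₁.IsCopyFixing G₂ {p, q, s} →
      G.numSpanningTrees =
        4 * G₁.numSpanningTrees * (G₁.identify {p, q, s} p).numSpanningTrees) := by
  classical
  have : Nonempty α := ⟨p⟩
  obtain ⟨o, ho⟩ := G.exists_isOrientation
  have ho₁ := ho.mono hG.left_le
  have ho₂ := ho.mono hG.right_le
  obtain ⟨E₁, hE₁⟩ := (hE.subset hG.left_le.edgeSet_mono).exists_finset_coe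
  obtain ⟨E₂, hE₂⟩ := (hE.subset hG.right_le.edgeSet_mono).exists_finset_coe
  obtain ⟨V₁, hV₁⟩ := (hV.subset hG.left_le.vertexSet_mono).exists_finset_coe
  obtain ⟨V₂, hV₂⟩ := (hV.subset hG.right_le.vertexSet_mono).exists_finset_coe
  have hVi : V₁ ∩ V₂ = {p, q, s} := by
    rw [← Finset.coe_inj]
    simpa [hV₁, hV₂] using hG.vertexSet_inter
  have hEd : Disjoint E₁ E₂ := by
    rw [← Finset.disjoint_coe, hE₁, hE₂, Set.disjoint_iff_inter_eq_empty]
    exact hG.edgeSet_inter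
  have hEu : ((E₁ ∪ E₂ : Finset β) : Set β) = E(G) := by
    rw [Finset.coe_union, hE₁, hE₂, hG.edgeSet_union]
  obtain ⟨I₁, hI₁⟩ : ∃ I, I = V₁ \ {p, q, s} := ⟨_, rfl⟩
  obtain ⟨I₂, hI₂⟩ : ∃ I, I = V₂ \ {p, q, s} := ⟨_, rfl⟩
  have hd₁ : Disjoint I₁ {p, q, s} := hI₁ ▸ Finset.sdiff_disjoint
  have hd₂ : Disjoint I₂ {p, q, s} := hI₂ ▸ Finset.sdiff_disjoint
  have hsub₁ : {p, q, s} ⊆ V₁ := hVi ▸ Finset.inter_subset_left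
  have hsub₂ : {p, q, s} ⊆ V₂ := hVi ▸ Finset.inter_subset_right
  have hIV₁ : ((I₁ ∪ {p, q, s} : Finset α) : Set α) = V(G₁) := by
    rw [hI₁, Finset.sdiff_union_of_subset hsub₁, hV₁]
  have hIV₂ : ((I₂ ∪ {p, q, s} : Finset α) : Set α) = V(G₂) := by
    rw [hI₂, Finset.sdiff_union_of_subset hsub₂, hV₂]
  have hdI : Disjoint I₁ I₂ := by
    rw [Finset.disjoint_left]
    intro x h1 h2
    rw [hI₁, ← hVi] at h1
    rw [hI₂] at h2
    simp only [Finset.mem_sdiff, Finset.mem_inter] at h1 h2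
    exact h1.2 ⟨h1.1, h2.1⟩
  have hn₁ : ∀ i ∈ I₁, i ∉ V(G₂) := by
    intro i hi h
    rw [← hIV₂, Finset.coe_union] at h
    rcases h with h | h
    · exact Finset.disjoint_left.1 hdI hi h
    · exact Finset.disjoint_left.1 hd₁ hi h
  have hn₂ : ∀ i ∈ I₂, i ∉ V(G₁) := by
    intro i hi h
    rw [← hIV₁, Finset.coe_union] at h
    rcases h with h | h
    · exact Finset.disjoint_left.1 hdI h hi
    · exact Finset.disjoint_left.1 hd₂ hi h
  obtain ⟨ht₁, hw₁, ha₁, hb₁, hc₁⟩ := Graph.numSpanningTrees_three ho₁ hE₁ hpq hps hqs hd₁ hIV₁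
  obtain ⟨ht₂, hw₂, ha₂, hb₂, hc₂⟩ := Graph.numSpanningTrees_three ho₂ hE₂ hpq hps hqs hd₂ hIV₂
  have hK : Graph.ratLaplacian o (E₁ ∪ E₂) =
      Graph.ratLaplacian o E₁ + Graph.ratLaplacian o E₂ := by
    ext x y
    simp only [Matrix.add_apply, Graph.ratLaplacian_apply, Finset.sum_union hEd]
  have htG : (G.numSpanningTrees : ℚ) =
      (Graph.ratLaplacian o (E₁ ∪ E₂)).principalMinor (I₁ ∪ (I₂ ∪ {p, q})) := by
    refine Graph.numSpanningTrees_eq_ratLaplacian ho hEu (r := s) ?_ ?_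
    · have h1 := Finset.disjoint_right.1 hd₁ (show s ∈ ({p, q, s} : Finset α) by simp)
      have h2 := Finset.disjoint_right.1 hd₂ (show s ∈ ({p, q, s} : Finset α) by simp)
      simp [h1, h2, hps.symm, hqs.symm]
    · rw [← hG.vertexSet_union, ← hIV₁, ← hIV₂, ← Finset.coe_union]
      congr 1
      ext x
      simp only [Finset.mem_insert, Finset.mem_union, Finset.mem_singleton]
      tauto
  have hgram := Graph.ratLaplacian_apply o
  set K₁ := Graph.ratLaplacian o E₁ with hK₁
  set K₂ := Graph.ratLaplacian o E₂ with hK₂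
  have hQ₁ : ∀ i ∈ I₁, ∀ x, K₂ i x = 0 :=
    fun i hi => Graph.ratLaplacian_eq_zero ho₂ hE₂ (hn₁ i hi)
  have hQ₂ : ∀ i ∈ I₂, ∀ x, K₁ i x = 0 :=
    fun i hi => Graph.ratLaplacian_eq_zero ho₁ hE₁ (hn₂ i hi)
  have h3₁ := Matrix.principalMinor_three hpq hps hqs hd₁ (Graph.ratLaplacian_isSymm o E₁)
    (Graph.sum_ratLaplacian ho₁ hE₁ hIV₁)
  have h3₂ := Matrix.principalMinor_three hpq hps hqs hd₂ (Graph.ratLaplacian_isSymm o E₂)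
    (Graph.sum_ratLaplacian ho₂ hE₂ hIV₂)
  -- Degenerate case: when a block to be eliminated is singular, all the minors containing it
  -- vanish, and so does `t(G)`.
  have hz₁ : K₁.principalMinor I₁ = 0 → ∀ T, K₁.principalMinor (I₁ ∪ T) = 0 := fun h T =>
    Matrix.principalMinor_eq_zero_of_subset (hgram E₁) Finset.subset_union_left h
  have hz₂ : K₂.principalMinor I₂ = 0 → ∀ T, K₂.principalMinor (I₂ ∪ T) = 0 := fun h T =>
    Matrix.principalMinor_eq_zero_of_subset (hgram E₂) Finset.subset_union_left h
  have hzG₁ : K₁.principalMinor I₁ = 0 → (G.numSpanningTrees : ℚ) = 0 := fun h => by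
    rw [htG]
    refine Matrix.principalMinor_eq_zero_of_subset (hgram _) Finset.subset_union_left ?_
    rw [← h, hK]
    exact Matrix.principalMinor_congr fun x hx y _ => by simp [hQ₁ x hx]
  have hzG₂ : K₂.principalMinor I₂ = 0 → (G.numSpanningTrees : ℚ) = 0 := fun h => by
    rw [htG]
    refine Matrix.principalMinor_eq_zero_of_subset (hgram _)
      (Finset.subset_union_left.trans Finset.subset_union_right) (I := I₂) ?_
    rw [← h, hK]
    exact Matrix.principalMinor_congr fun x hx y _ => by simp [hQ₂ x hx]
  have formula : (G.numSpanningTrees : ℚ) =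
      K₁.principalMinor (I₁ ∪ {p, q}) * K₂.principalMinor I₂ +
      K₂.principalMinor (I₂ ∪ {p, q}) * K₁.principalMinor I₁ +
      1 / 2 * (K₁.principalMinor (I₁ ∪ {q}) * (-K₂.principalMinor (I₂ ∪ {q}) +
          K₂.principalMinor (I₂ ∪ {s}) + K₂.principalMinor (I₂ ∪ {p})) +
        K₁.principalMinor (I₁ ∪ {s}) * (K₂.principalMinor (I₂ ∪ {q}) -
          K₂.principalMinor (I₂ ∪ {s}) + K₂.principalMinor (I₂ ∪ {p})) +
        K₁.principalMinor (I₁ ∪ {p}) * (K₂.principalMinor (I₂ ∪ {q}) +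
          K₂.principalMinor (I₂ ∪ {s}) - K₂.principalMinor (I₂ ∪ {p}))) := by
    by_cases h₁ : K₁.principalMinor I₁ = 0
    · rw [hzG₁ h₁, h₁]
      simp only [hz₁ h₁]
      ring
    by_cases h₂ : K₂.principalMinor I₂ = 0
    · rw [hzG₂ h₂, h₂]
      simp only [hz₂ h₂]
      ring
    obtain ⟨t₁, a₁, b₁, c₁⟩ := h3₁ h₁
    obtain ⟨t₂, a₂, b₂, c₂⟩ := h3₂ h₂
    have hJT : Disjoint I₂ {p, q} := Finset.disjoint_of_subset_right (by grind) hd₂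
    have hIJ : Disjoint I₁ (I₂ ∪ {p, q}) := Finset.disjoint_union_right.2
      ⟨hdI, Finset.disjoint_of_subset_right (by grind) hd₁⟩
    rw [htG, hK, Matrix.principalMinor_add_union hIJ hJT (Graph.ratLaplacian_isSymm o E₁)
      (Graph.ratLaplacian_isSymm o E₂) hQ₂ hQ₁ h₁ h₂, Matrix.principalMinor_pair _ hpq,
      t₁, a₁, b₁, c₁, t₂, a₂, b₂, c₂]
    simp only [Matrix.add_apply, Matrix.schurComplement_symm (Graph.ratLaplacian_isSymm o E₁) q p,
      Matrix.schurComplement_symm (Graph.ratLaplacian_isSymm o E₂) q p, hK₁, hK₂]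
    -- With `x, y, z` the entries `pp, qq, pq` of `Sᵢ`, the mixed part of the determinant is `x₁y₂ +
    -- x₂y₁ - 2z₁z₂`. Substituting `2z = (b - a - c) / w` on each side gives the bracket with its
    -- factor `1/2`.
    ring
  constructor
  · rintro _ _ _ _ _ _ rfl rfl rfl rfl rfl rfl
    rw [formula, ht₁, hw₁, ha₁, hb₁, hc₁, ht₂, hw₂, ha₂, hb₂, hc₂]
  · rintro ⟨f, g, hf, hg, hfg, hfix⟩
    -- Since `f` fixes the terminals, it matches the remaining vertices of the two sides.
    have hfI : Set.BijOn f I₁ I₂ := by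
      have h1 : (I₁ : Set α) = V(G₁) \ {p, q, s} := by rw [hI₁]; simp [hV₁]
      have h2 : (I₂ : Set α) = V(G₂) \ {p, q, s} := by rw [hI₂]; simp [hV₂]
      have hfS : f '' {p, q, s} = {p, q, s} := by
        rw [Set.image_congr hfix, Set.image_id']
      have hS : {p, q, s} ⊆ V(G₁) := hG.vertexSet_inter ▸ Set.inter_subset_left
      have hinj : Set.InjOn f I₁ := hf.injOn.mono (h1 ▸ Set.sdiff_subset)
      have him : f '' (I₁ : Set α) = I₂ := by
        rw [h1, h2, hf.injOn.image_sdiff_subset hS, hf.image_eq, hfS]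
      exact him ▸ hinj.bijOn_image
    have hcopy : ∀ T ⊆ ({p, q, s} : Finset α),
        K₁.principalMinor (I₁ ∪ T) = K₂.principalMinor (I₂ ∪ T) := by
      intro T hT
      have hsub : ∀ x ∈ I₁ ∪ T, x ∈ V(G₁) := fun x hx => by
        rw [← hIV₁]
        exact Finset.union_subset_union_right hT hx
      refine Matrix.principalMinor_reindex f ?_ fun x hx y hy =>
        Graph.ratLaplacian_copy ho₁ ho₂ hE₁ hE₂ hf.injOn hg hfg (hsub x hx) (hsub y hy)
      have hfT : Set.BijOn f (T : Set α) T :=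
        (Set.bijOn_id _).congr fun x hx => (hfix x (by simpa using hT hx)).symm
      rw [Finset.coe_union, Finset.coe_union]
      exact hfI.union hfT (hf.injOn.mono fun x hx => hsub x (by simpa using hx))
    have hw := hcopy ∅ (by simp)
    rw [Finset.union_empty, Finset.union_empty] at hw
    rw [← hcopy {p, q} (by grind), ← hcopy {p} (by grind), ← hcopy {q} (by grind),
      ← hcopy {s} (by grind), ← hw] at formula
    have : (G.numSpanningTrees : ℚ) =
        4 * G₁.numSpanningTrees * (G₁.identify {p, q, s} p).numSpanningTrees := by
      rw [ht₁, hw₁]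
      by_cases h₁ : K₁.principalMinor I₁ = 0
      · rw [hzG₁ h₁, h₁, mul_zero]
      obtain ⟨t₁, a₁, b₁, c₁⟩ := h3₁ h₁
      rw [formula, t₁, a₁, b₁, c₁]
      -- For equal sides the bracket is `4ac - (a + c - b)²`, which equals `4 t(G₁) w₁`. Its half is
      -- added to `2 t(G₁) w₁`.
      ring
    exact_mod_cast this
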